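/- Let $\Omega$ be a measurable space, $G_0$ a finite non-zero measure on $\Omega$ with total mass $\gamma_0=G_0(\Omega)$ and $g_0=G_0/\gamma_0$, and let $\rho$ be a measure on $\mathbb R_+=[0,\infty)$ with $\rho((0,\infty))>0$ such that $\nu(dr\,d\omega)=\rho(dr)G_0(d\omega)$ satisfies $\iint_{\mathbb R_+\times A}\min\{1,r\}\,\nu(dr\,d\omega)<\infty$ for every measurable $A\subset\Omega$. Let $G=\sum_{k=1}^K r_k\delta_{\omega_k}$ ($K\le\infty$) be a completely random measure with Lévy measure $\nu$: a random measure such that each $G(A)$ is almost surely finite, $G(A_1),G(A_2),\dots$ are independent for pairwise disjoint measurable $A_i$, and $$\mathbb E\big[e^{iuG(A)}\big]=\exp\Big\{\iint_{\mathbb R_+\times A}(e^{iur}-1)\,\nu(dr\,d\omega)\Big\}\qquad(u\in\mathbb R).$$ Given the weights $(r_k)$ and the atoms $(\omega_k)$, let the counts $n_k\sim\mathrm{Pois}(r_k)$ be independent, and put $X=\sum_{k=1}^K n_k\delta_{\omega_k}$. Then $0<\int_0^\infty(1-e^{-r})\rho(dr)<\infty$, $\int_0^\infty r^je^{-r}\rho(dr)<\infty$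 for all $j\ge1$, and $X$ is a compound Poisson process: as a random measure it has the same law as $$\sum_{k=1}^{l} n'_k\,\delta_{\omega'_k},\qquad l\sim\mathrm{Pois}\Big(\gamma_0\int_0^\infty(1-e^{-r})\rho(dr)\Big),\qquad \omega'_k\overset{iid}{\sim}g_0,\qquad n'_k\overset{iid}{\sim}\sum_{j=1}^\infty\frac{\int_0^\infty r^je^{-r}\rho(dr)}{j!\int_0^\infty(1-e^{-r})\rho(dr)}\,\delta_j,$$ where $l$, $(n'_k)_k$ and $(\omega'_k)_k$ are independent. If moreover $G_0$ has no atoms and the points of $\Omega$ are separated by countably many measurable sets (for instance, if $\Omega$ is a standard Borel space), then the number of clusters, that is, of points $\omega\in\Omega$ with $X(\{\omega\})>0$, is Poisson distributed with mean $\gamma_0\int_0^\infty(1-e^{-r})\rho(dr)$. -/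

import Mathlib

open MeasureTheory ProbabilityTheory
open scoped NNReal ENNReal

noncomputable section

namespace CountMixture

universe u v

/-- The purely atomic measure `∑ₖ wₖ δ_{xₖ}`. A sum with `K < ∞` terms is the case in which
`wₖ = 0` for all remaining indices. -/
def atomic {S : Type u} [MeasurableSpace S] (w : ℕ → ℝ≥0∞) (x : ℕ → S) : Measure S :=
  Measure.sum fun k => w k • Measure.dirac (x k)

/-- The condition `∫∫_{ℝ₊ × A} min(1, r) ν(dr dω) < ∞` for all measurable `A`. -/
def IsLevyMeasure {S : Type u} [MeasurableSpace S] (ν : Measure (ℝ≥0 × S)) : Prop :=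
  ∀ A : Set S, MeasurableSet A → ∫⁻ p in Set.univ ×ˢ A, min 1 (p.1 : ℝ≥0∞) ∂ν < ∞

/-- `G` is a completely random measure on `S` with Lévy measure `ν`: a random measure with finite
values, independent on disjoint sets, and with characteristic functions
`E[exp(iuG(A))] = exp(∫∫_{ℝ₊ × A} (exp(iur) - 1) ν(dr dω))`. -/
structure IsCompletelyRandomMeasure {S : Type u} [MeasurableSpace S] {Θ : Type v}
    [MeasurableSpace Θ] (P : Measure Θ) (G : Θ → Measure S) (ν : Measure (ℝ≥0 × S)) : Prop where
  measurable : Measurable G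
  finite : ∀ A : Set S, MeasurableSet A → ∀ᵐ θ ∂P, G θ A < ∞
  indep : ∀ A : ℕ → Set S, (∀ i, MeasurableSet (A i)) → Pairwise (Function.onFun Disjoint A) →
    iIndepFun (fun i θ => G θ (A i)) P
  charFun_eq : ∀ A : Set S, MeasurableSet A → ∀ t : ℝ,
    ∫ θ, Complex.exp (t * (G θ).real A * Complex.I) ∂P =
      Complex.exp (∫ p in Set.univ ×ˢ A, (Complex.exp (t * (p.1 : ℝ) * Complex.I) - 1) ∂ν)

/-- The count-mixture model with random weights `rₖ`, atoms `ωₖ` and counts `nₖ`: the random measure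
`G = ∑ₖ rₖ δ_{ωₖ}` is a completely random measure with Lévy measure `ν` and, given the weights and
atoms, the counts are independent with `nₖ ∼ Pois(rₖ)`. -/
structure IsCountMixtureModel {S : Type u} [MeasurableSpace S] {Θ : Type v}
    [MeasurableSpace Θ] (P : Measure Θ) (ν : Measure (ℝ≥0 × S))
    (r : ℕ → Θ → ℝ≥0) (ω : ℕ → Θ → S) (n : ℕ → Θ → ℕ) : Prop where
  measurable_weight : ∀ k, Measurable (r k)
  measurable_atom : ∀ k, Measurable (ω k)
  measurable_count : ∀ k, Measurable (n k)
  isCRM : IsCompletelyRandomMeasure P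
    (fun θ => atomic (fun k => (r k θ : ℝ≥0∞)) (fun k => ω k θ)) ν
  count_condLaw : ∀ (s : Finset ℕ) (j : ℕ → ℕ),
    P[{θ | ∀ k ∈ s, n k θ = j k}.indicator (fun _ => (1 : ℝ)) |
        MeasurableSpace.comap (fun θ k => (r k θ, ω k θ)) inferInstance]
      =ᵐ[P] fun θ => ∏ k ∈ s, (poissonMeasure (r k θ)).real {j k}

/-- The random measure `X = ∑ₖ nₖ δ_{ωₖ}`. -/
def countMeasure {S : Type u} [MeasurableSpace S] {Θ : Type v}
    (ω : ℕ → Θ → S) (n : ℕ → Θ → ℕ) (θ : Θ) : Measure S :=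
  atomic (fun k => (n k θ : ℝ≥0∞)) (fun k => ω k θ)

/-- `X` is a compound Poisson process with rate `lam`, size law `q` and location law `g`: it has
the law of `∑_{k < l} nₖ δ_{ωₖ}`, with `l ∼ Pois(lam)`, `nₖ` iid from `q`, `ωₖ` iid from `g`, all
independent. -/
def IsCompoundPoissonProcess {S : Type u} [MeasurableSpace S] {Θ : Type v}
    [MeasurableSpace Θ] (P : Measure Θ) (X : Θ → Measure S)
    (lam : ℝ≥0) (q : Measure ℕ) (g : Measure S) : Prop :=
  ∃ (Θ' : Type u) (_ : MeasurableSpace Θ') (Q : Measure Θ') (_ : IsProbabilityMeasure Q)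
    (l : Θ' → ℕ) (n : ℕ → Θ' → ℕ) (ω : ℕ → Θ' → S),
    HasLaw l (poissonMeasure lam) Q ∧ (∀ k, HasLaw (n k) q Q) ∧ (∀ k, HasLaw (ω k) g Q) ∧
    (∀ k, IndepFun (n k) (ω k) Q) ∧
    iIndepFun (fun k θ => (n k θ, ω k θ)) Q ∧
    IndepFun l (fun θ k => (n k θ, ω k θ)) Q ∧
    IdentDistrib X
      (fun θ => ∑ k ∈ Finset.range (l θ), (n k θ : ℝ≥0∞) • Measure.dirac (ω k θ)) P Q

/-- The probability of cluster size `j`: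
`∫ r^j e^{-r} ρ(dr) / (j! ∫ (1 - e^{-r}) ρ(dr))`. -/
def sizeProb (ρ : Measure ℝ≥0) (j : ℕ) : ℝ :=
  (∫ r : ℝ≥0, (r : ℝ) ^ j * Real.exp (-r) ∂ρ) /
    (j.factorial * ∫ r : ℝ≥0, (1 - Real.exp (-r)) ∂ρ)

/-- The cluster size law `∑_{j ≥ 1} sizeProb ρ j • δ_j`. -/
def sizeLaw (ρ : Measure ℝ≥0) : Measure ℕ :=
  Measure.sum fun i : ℕ => ENNReal.ofReal (sizeProb ρ (i + 1)) • Measure.dirac (i + 1)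

/-- The mean number of clusters `γ₀ ∫ (1 - e^{-r}) ρ(dr)`, where `γ₀` is the mass of `G₀`. -/
def clusterRate {S : Type u} [MeasurableSpace S] (ρ : Measure ℝ≥0) (G₀ : Measure S) : ℝ≥0 :=
  (G₀.real Set.univ * ∫ r : ℝ≥0, (1 - Real.exp (-r)) ∂ρ).toNNReal

/-- The base distribution `g₀ = G₀ / γ₀`. -/
def baseLaw {S : Type u} [MeasurableSpace S] (G₀ : Measure S) : Measure S :=
  (G₀ Set.univ)⁻¹ • G₀

end CountMixture

end

/-!
The law of a random measure is determined by its Laplace functional `f ↦ E[exp (-∫ f dX)]`, because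
the functions `x ↦ exp (-∑ kᵢ xᵢ)` with `kᵢ ∈ ℕ` span a point-separating algebra. So it suffices
to compare two Laplace functionals.

For a completely random measure the characteristic functions are given. Both sides of the formula
extend to bounded holomorphic functions on the right half-plane, hence agree there by
Phragmén–Lindelöf, and on the positive axis they read
`E[exp (-∫ f dG)] = exp (-∫∫ (1 - exp (-r f)) dν)`, first for simple `f`. Since
`E[exp (-f n)] = exp (-r (1 - exp (-f)))` for `n ∼ Pois(r)`, passing from `G` to `X` replaces `f` by
`1 - exp (-f)`. The compound Poisson process has the same functional, because its size law
multiplied by `∫ (1 - exp (-r)) ρ(dr)` is the restriction to positive counts of the Poisson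
mixture `∫ Pois(r) ρ(dr)`.

If the location law has no atoms, the locations are almost surely distinct and the compound Poisson
measure with `l` terms has exactly `l` atoms. This transfers to `X` because the number of atoms of
an atomic measure is the limit of the numbers of charged cells in a refining sequence of finite
measurable partitions, and so a measurable function of the measure.
-/

noncomputable section

namespace CountMixture

section Laplace

variable {α β : Type*} [MeasurableSpace α] [MeasurableSpace β] {P : Measure α} {μ : Measure β}

lemma norm_cexp_sub_one_le {w : ℂ} (hw : w.re ≤ 0) : ‖Complex.exp w - 1‖ ≤ min 2 ‖w‖ := by
  have hexp : ∀ w ∈ {w : ℂ | w.re ≤ 0}, ‖Complex.exp w‖ ≤ 1 := fun w hw => by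
    simpa [Complex.norm_exp] using hw
  refine le_min ((norm_sub_le _ _).trans ?_) ?_
  · rw [norm_one, ← one_add_one_eq_two]
    exact add_le_add_left (hexp w hw) 1
  · simpa using Convex.norm_image_sub_le_of_norm_deriv_le (C := 1)
      (fun _ _ => Complex.differentiableAt_exp) (by simpa using hexp)
      (convex_halfSpace_re_le 0) (x := 0) (by simp) hw

lemma norm_cexp_neg_mul_sub_one_le {z : ℂ} (hz : 0 ≤ z.re) (x : ℝ≥0) :
    ‖Complex.exp (-z * (x : ℝ)) - 1‖ ≤ max 2 ‖z‖ * min 1 (x : ℝ) := by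
  have hre : (-z * (x : ℝ)).re ≤ 0 := by simpa using mul_nonneg hz x.coe_nonneg
  calc ‖Complex.exp (-z * (x : ℝ)) - 1‖ ≤ min 2 (‖z‖ * x) := by
        simpa using norm_cexp_sub_one_le hre
    _ ≤ min (max 2 ‖z‖ * 1) (max 2 ‖z‖ * x) := by
        rw [mul_one]
        gcongr
        exacts [le_max_left _ _, le_max_right _ _]
    _ = max 2 ‖z‖ * min 1 (x : ℝ) := (mul_min_of_nonneg _ _ (by positivity)).symm

lemma exp_neg_mul_mul_self_le {b : ℝ} (hb : 0 < b) (x : ℝ≥0) :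
    Real.exp (-(b * x)) * x ≤ max 1 b⁻¹ * min 1 (x : ℝ) := by
  have hx : (0 : ℝ) ≤ x := x.coe_nonneg
  have hinv : Real.exp (-(b * x)) * x ≤ b⁻¹ := by
    rw [Real.exp_neg, inv_mul_le_iff₀ (Real.exp_pos _), ← div_eq_mul_inv, le_div_iff₀ hb]
    linarith [Real.add_one_le_exp (b * x)]
  have hself : Real.exp (-(b * x)) * x ≤ x :=
    mul_le_of_le_one_left hx (Real.exp_le_one_iff.2 (neg_nonpos.2 (by positivity)))
  rw [mul_min_of_nonneg _ _ (by positivity), mul_one]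
  exact le_min (hinv.trans (le_max_right _ _))
    (hself.trans (le_mul_of_one_le_left hx (le_max_left _ _)))

/-- The exponent `∫ (exp (-z V) - 1) dμ` of the Lévy–Khintchine formula, as a function of the
complex variable `z` in the closed right half-plane. -/
def laplaceExponent (μ : Measure β) (V : β → ℝ≥0) (z : ℂ) : ℂ :=
  ∫ b, (Complex.exp (-z * (V b : ℝ)) - 1) ∂μ

section Exponent

variable {V : β → ℝ≥0} (hV : Measurable V) (hint : Integrable (fun b => min 1 (V b : ℝ)) μ)

include hV hint

lemma integrable_cexp_neg_mul_sub_one {z : ℂ} (hz : 0 ≤ z.re) :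
    Integrable (fun b => Complex.exp (-z * (V b : ℝ)) - 1) μ :=
  (hint.const_mul (max 2 ‖z‖)).mono' (by fun_prop)
    (.of_forall fun b => norm_cexp_neg_mul_sub_one_le hz (V b))

lemma differentiableAt_laplaceExponent {z : ℂ} (hz : 0 < z.re) :
    DifferentiableAt ℂ (laplaceExponent μ V) z := by
  obtain ⟨b, hb, hbz⟩ := exists_between hz
  have hs : {w : ℂ | b < w.re} ∈ nhds z :=
    (isOpen_lt continuous_const Complex.continuous_re).mem_nhds hbz
  refine (hasDerivAt_integral_of_dominated_loc_of_deriv_le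
    (F' := fun w a => Complex.exp (-w * (V a : ℝ)) * (-(V a : ℝ)))
    (bound := fun a => max 1 b⁻¹ * min 1 (V a : ℝ)) hs
    (.of_forall fun w => by fun_prop) (integrable_cexp_neg_mul_sub_one hV hint hz.le)
    (by fun_prop) (.of_forall fun a w hw => ?_) (hint.const_mul _)
    (.of_forall fun a w _ => ?_)).2.differentiableAt
  · refine le_trans ?_ (exp_neg_mul_mul_self_le hb (V a))
    rw [norm_mul, Complex.norm_exp, norm_neg, Complex.norm_real, NNReal.norm_eq]
    gcongr
    simpa using mul_le_mul_of_nonneg_right (le_of_lt hw) (V a).coe_nonneg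
  · have h : HasDerivAt (fun w : ℂ => -w * (V a : ℝ)) (-(V a : ℝ)) w := by
      simpa using (hasDerivAt_id w).neg.mul_const ((V a : ℝ) : ℂ)
    exact h.cexp.sub_const 1

lemma continuousOn_laplaceExponent : ContinuousOn (laplaceExponent μ V) {z | 0 ≤ z.re} := by
  intro z _
  refine continuousWithinAt_of_dominated (bound := fun b => max 2 (‖z‖ + 1) * min 1 (V b : ℝ))
    (.of_forall fun w => by fun_prop) ?_ (hint.const_mul _) (.of_forall fun b => by fun_prop)
  have hnorm : ∀ᶠ w in nhdsWithin z {z : ℂ | 0 ≤ z.re}, ‖w‖ < ‖z‖ + 1 :=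
    nhdsWithin_le_nhds ((isOpen_lt continuous_norm continuous_const).mem_nhds (by simp))
  filter_upwards [hnorm, self_mem_nhdsWithin] with w hw hw0
  refine .of_forall fun b => (norm_cexp_neg_mul_sub_one_le hw0 (V b)).trans ?_
  gcongr

lemma diffContOnCl_laplaceExponent : DiffContOnCl ℂ (laplaceExponent μ V) {z | 0 < z.re} where
  differentiableOn _ hz :=
    (differentiableAt_laplaceExponent hV hint hz).differentiableWithinAt
  continuousOn := by
    rw [Complex.closure_setOfPred_lt_re]
    exact continuousOn_laplaceExponent hV hint

lemma re_laplaceExponent_nonpos {z : ℂ} (hz : 0 ≤ z.re) : (laplaceExponent μ V z).re ≤ 0 := by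
  have hre := integral_re (𝕜 := ℂ) (integrable_cexp_neg_mul_sub_one hV hint hz)
  rw [RCLike.re_to_complex] at hre
  rw [laplaceExponent, ← hre]
  refine integral_nonpos fun b => ?_
  have hexp : ‖Complex.exp (-z * (V b : ℝ))‖ ≤ 1 := by
    simpa [Complex.norm_exp] using mul_nonneg hz (V b).coe_nonneg
  simpa using (Complex.re_le_norm _).trans hexp

end Exponent

lemma laplaceExponent_ofReal (V : β → ℝ≥0) (u : ℝ) :
    laplaceExponent μ V u = ((-∫ b, (1 - Real.exp (-(u * V b))) ∂μ : ℝ) : ℂ) := by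
  rw [laplaceExponent, ← integral_neg, ← integral_complex_ofReal]
  simp

lemma integrable_min_one_coe [IsFiniteMeasure P] {V : α → ℝ≥0} (hV : Measurable V) :
    Integrable (fun a => min 1 (V a : ℝ)) P :=
  (integrable_const (1 : ℝ)).mono' (by fun_prop) (.of_forall fun a => by
    rw [Real.norm_of_nonneg (by positivity)]
    exact min_le_left _ _)

lemma one_add_laplaceExponent [IsProbabilityMeasure P] {V : α → ℝ≥0} (hV : Measurable V) {z : ℂ}
    (hz : 0 ≤ z.re) : 1 + laplaceExponent P V z = ∫ a, Complex.exp (-z * (V a : ℝ)) ∂P := by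
  have hint := integrable_cexp_neg_mul_sub_one hV (integrable_min_one_coe (P := P) hV) hz
  have hexp : Integrable (fun a => Complex.exp (-z * (V a : ℝ))) P :=
    (hint.add (integrable_const 1)).congr (.of_forall fun a => by simp)
  rw [laplaceExponent, integral_sub hexp (integrable_const 1)]
  simp

lemma eqOn_right_half_plane_of_eq_on_imaginary_axis {F H : ℂ → ℂ} {C : ℝ}
    (hF : DiffContOnCl ℂ F {z | 0 < z.re}) (hH : DiffContOnCl ℂ H {z | 0 < z.re})
    (hFC : ∀ z : ℂ, 0 ≤ z.re → ‖F z‖ ≤ C) (hHC : ∀ z : ℂ, 0 ≤ z.re → ‖H z‖ ≤ C)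
    (heq : ∀ t : ℝ, F (t * Complex.I) = H (t * Complex.I)) {z : ℂ} (hz : 0 ≤ z.re) :
    F z = H z := by
  have hbound : ∀ z : ℂ, 0 ≤ z.re → ‖(F - H) z‖ ≤ C + C := fun z hz =>
    (norm_sub_le _ _).trans (add_le_add (hFC z hz) (hHC z hz))
  have hzero : ‖(F - H) z‖ ≤ 0 := by
    refine PhragmenLindelof.right_half_plane_of_bounded_on_real (hF.sub hH)
      ⟨1, one_lt_two, 0, .of_bound (C + C) (Filter.eventually_inf_principal.2
        (.of_forall fun w hw => ?_))⟩
      ⟨C + C, Filter.eventually_map.2 ?_⟩ (fun t => ?_) hz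
    · simpa using hbound w (le_of_lt hw)
    · filter_upwards [Filter.eventually_ge_atTop 0] with x hx
      exact hbound x (by simpa using hx)
    · simp [heq t]
  exact sub_eq_zero.1 (norm_le_zero_iff.1 hzero)

theorem integral_exp_neg_mul_of_charFun_eq [IsProbabilityMeasure P] {V : α → ℝ≥0}
    (hV : Measurable V) {W : β → ℝ≥0} (hW : Measurable W)
    (hint : Integrable (fun b => min 1 (W b : ℝ)) μ)
    (hchar : ∀ t : ℝ, ∫ a, Complex.exp (t * (V a : ℝ) * Complex.I) ∂P =
      Complex.exp (∫ b, (Complex.exp (t * (W b : ℝ) * Complex.I) - 1) ∂μ)) (u : ℝ≥0) :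
    ∫ a, Real.exp (-(u * V a)) ∂P = Real.exp (-∫ b, (1 - Real.exp (-(u * W b))) ∂μ) := by
  have hre {z : ℂ} (hz : 0 ≤ z.re) (x : ℝ≥0) : (-z * (x : ℝ)).re ≤ 0 := by
    simpa using mul_nonneg hz x.coe_nonneg
  have haxis (t : ℝ) : 1 + laplaceExponent P V (t * Complex.I) =
      Complex.exp (laplaceExponent μ W (t * Complex.I)) := by
    have hcomm (x : ℝ≥0) :
        -(t * Complex.I) * (x : ℝ) = (-t : ℝ) * (x : ℝ) * Complex.I := by push_cast; ring
    rw [one_add_laplaceExponent hV (by simp), laplaceExponent]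
    simp only [hcomm, hchar]
  have hu : (0 : ℝ) ≤ (u : ℂ).re := by simp
  have key := eqOn_right_half_plane_of_eq_on_imaginary_axis (C := 1)
    ((diffContOnCl_laplaceExponent hV (integrable_min_one_coe (P := P) hV)).const_add 1)
    (Complex.differentiable_exp.comp_diffContOnCl (diffContOnCl_laplaceExponent hW hint))
    (fun z hz => ?_) (fun z hz => ?_) haxis hu
  · simp only [Function.comp_apply] at key
    rw [one_add_laplaceExponent hV hu] at key
    change _ = Complex.exp (laplaceExponent μ W ((u : ℝ) : ℂ)) at key
    rw [laplaceExponent_ofReal, ← Complex.ofReal_exp] at key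
    rw [← Complex.ofReal_inj, ← key, ← integral_complex_ofReal]
    simp
  · rw [one_add_laplaceExponent hV hz]
    refine (norm_integral_le_of_norm_le_const (C := 1) (.of_forall fun a => ?_)).trans (by simp)
    simpa [Complex.norm_exp] using hre hz (V a)
  · simpa [Complex.norm_exp] using re_laplaceExponent_nonpos hW hint hz

lemma integrable_one_sub_exp_neg_mul {W : β → ℝ≥0} (hW : Measurable W)
    (hint : Integrable (fun b => min 1 (W b : ℝ)) μ) (u : ℝ≥0) :
    Integrable (fun b => 1 - Real.exp (-(u * W b))) μ := by
  have hu : (0 : ℝ) ≤ ((u : ℝ) : ℂ).re := u.coe_nonneg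
  refine (integrable_cexp_neg_mul_sub_one hW hint hu).re.neg.congr (.of_forall fun b => ?_)
  have hexp : Complex.exp (-(u : ℝ) * (W b : ℝ)) = (Real.exp (-(u * W b)) : ℝ) := by simp
  change -(Complex.exp (-(u : ℝ) * (W b : ℝ)) - 1).re = _
  rw [hexp, ← Complex.ofReal_one, ← Complex.ofReal_sub, Complex.ofReal_re, neg_sub]

end Laplace

/-- The map `x ↦ exp (-x)` on `[0, ∞]`, with `exp (-∞) = 0`. Laplace functionals of random measures
are expectations of `expNeg` of an integral. -/
def expNeg (x : ℝ≥0∞) : ℝ≥0∞ := EReal.exp (-(x : EReal))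

lemma continuous_expNeg : Continuous expNeg :=
  ENNReal.continuous_exp.comp (continuous_neg.comp continuous_coe_ennreal_ereal)

@[fun_prop]
lemma measurable_expNeg : Measurable expNeg := continuous_expNeg.measurable

@[simp]
lemma expNeg_zero : expNeg 0 = 1 := by simp [expNeg]

lemma antitone_expNeg : Antitone expNeg := fun x y hxy =>
  EReal.exp_monotone (EReal.neg_le_neg_iff.2 (by exact_mod_cast hxy))

lemma expNeg_add (x y : ℝ≥0∞) : expNeg (x + y) = expNeg x * expNeg y := by
  rw [expNeg, expNeg, expNeg, ← EReal.exp_add, EReal.coe_ennreal_add, EReal.neg_add, sub_eq_add_neg]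
  · exact Or.inl (EReal.coe_ennreal_ne_bot _)
  · exact Or.inr (EReal.coe_ennreal_ne_bot _)

lemma expNeg_sum {ι : Type*} (s : Finset ι) (f : ι → ℝ≥0∞) :
    expNeg (∑ i ∈ s, f i) = ∏ i ∈ s, expNeg (f i) := by
  classical
  induction s using Finset.induction_on with
  | empty => simp
  | insert i s hi ih => rw [Finset.sum_insert hi, Finset.prod_insert hi, expNeg_add, ih]

lemma expNeg_natCast_mul (n : ℕ) (x : ℝ≥0∞) : expNeg (n * x) = expNeg x ^ n := by
  simpa using expNeg_sum (Finset.range n) (fun _ => x)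

lemma expNeg_le_one (x : ℝ≥0∞) : expNeg x ≤ 1 := by
  rw [expNeg, EReal.exp_le_one_iff, EReal.neg_le_zero]
  exact EReal.coe_ennreal_nonneg x

lemma expNeg_ofReal {x : ℝ} (hx : 0 ≤ x) :
    expNeg (ENNReal.ofReal x) = ENNReal.ofReal (Real.exp (-x)) := by
  rw [expNeg, EReal.coe_ennreal_ofReal, max_eq_left hx, ← EReal.coe_neg, EReal.exp_coe]

lemma expNeg_coe (x : ℝ≥0) : expNeg x = ENNReal.ofReal (Real.exp (-x)) := by
  rw [← expNeg_ofReal x.coe_nonneg, ENNReal.ofReal_coe_nnreal]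

lemma one_sub_expNeg_coe (x : ℝ≥0) : 1 - expNeg x = ENNReal.ofReal (1 - Real.exp (-x)) := by
  rw [expNeg_coe, ← ENNReal.ofReal_one, ENNReal.ofReal_sub _ (Real.exp_pos _).le]

lemma tendsto_lintegral_expNeg {α : Type*} [MeasurableSpace α] {P : Measure α} [IsFiniteMeasure P]
    {F : ℕ → α → ℝ≥0∞} {f : α → ℝ≥0∞} (hF : ∀ n, Measurable (F n))
    (hlim : ∀ a, Filter.Tendsto (F · a) Filter.atTop (nhds (f a))) :
    Filter.Tendsto (fun n => ∫⁻ a, expNeg (F n a) ∂P) Filter.atTop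
      (nhds (∫⁻ a, expNeg (f a) ∂P)) :=
  tendsto_lintegral_of_dominated_convergence 1 (fun n => by have := hF n; fun_prop)
    (fun n => .of_forall fun a => expNeg_le_one _) (by simp)
    (.of_forall fun a => (continuous_expNeg.tendsto _).comp (hlim a))

theorem lintegral_expNeg_mul_of_charFun_eq {α β : Type*} [MeasurableSpace α] [MeasurableSpace β]
    {P : Measure α} [IsProbabilityMeasure P] {μ : Measure β} {V : α → ℝ≥0}
    (hV : Measurable V) {W : β → ℝ≥0} (hW : Measurable W)
    (hint : Integrable (fun b => min 1 (W b : ℝ)) μ)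
    (hchar : ∀ t : ℝ, ∫ a, Complex.exp (t * (V a : ℝ) * Complex.I) ∂P =
      Complex.exp (∫ b, (Complex.exp (t * (W b : ℝ) * Complex.I) - 1) ∂μ)) (u : ℝ≥0) :
    ∫⁻ a, expNeg (u * V a) ∂P = expNeg (∫⁻ b, (1 - expNeg (u * W b)) ∂μ) := by
  have hpos (b : β) : 0 ≤ 1 - Real.exp (-(u * W b)) := by
    rw [sub_nonneg, Real.exp_le_one_iff, neg_nonpos]
    positivity
  have hexp : Integrable (fun a => Real.exp (-(u * V a))) P :=
    ((integrable_const 1).sub (integrable_one_sub_exp_neg_mul hV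
      (integrable_min_one_coe hV) u)).congr (.of_forall fun a => by simp)
  simp only [← ENNReal.coe_mul, one_sub_expNeg_coe]
  simp only [expNeg_coe, NNReal.coe_mul]
  rw [← ofReal_integral_eq_lintegral_ofReal hexp (.of_forall fun a => (Real.exp_pos _).le),
    ← ofReal_integral_eq_lintegral_ofReal (integrable_one_sub_exp_neg_mul hW hint u)
      (.of_forall hpos), expNeg_ofReal (integral_nonneg hpos),
    integral_exp_neg_mul_of_charFun_eq hV hW hint hchar]

section CompletelyRandom

variable {S Θ : Type*} [MeasurableSpace S] [MeasurableSpace Θ] {P : Measure Θ}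
  {G : Θ → Measure S} {ν : Measure (ℝ≥0 × S)}

lemma IsLevyMeasure.integrableOn_min (hν : IsLevyMeasure ν) {A : Set S} (hA : MeasurableSet A) :
    IntegrableOn (fun p => min 1 (p.1 : ℝ)) (Set.univ ×ˢ A) ν := by
  refine ⟨by fun_prop, ?_⟩
  rw [hasFiniteIntegral_iff_ofReal (.of_forall fun p => by positivity)]
  simpa using hν A hA

namespace IsCompletelyRandomMeasure

lemma iIndepFun_of_countable {ι : Type*} [Countable ι] (hG : IsCompletelyRandomMeasure P G ν)
    {A : ι → Set S} (hA : ∀ i, MeasurableSet (A i)) (hdisj : Pairwise (Function.onFun Disjoint A)) :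
    iIndepFun (fun i θ => G θ (A i)) P := by
  obtain ⟨e, he⟩ := exists_injective_nat ι
  have hindep := hG.indep (Function.extend e A fun _ => ∅) (fun k => ?_) (fun j k hjk => ?_)
  · simpa only [he.extend_apply] using hindep.precomp he
  · by_cases hk : ∃ i, e i = k
    · obtain ⟨i, rfl⟩ := hk
      simpa only [he.extend_apply] using hA i
    · simp [Function.extend_apply' _ _ _ hk]
  · by_cases hj : ∃ i, e i = j
    · by_cases hk : ∃ i, e i = k
      · obtain ⟨i, rfl⟩ := hj
        obtain ⟨i', rfl⟩ := hk
        simpa only [Function.onFun, he.extend_apply] using hdisj fun h => hjk (congrArg e h)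
      · simp [Function.onFun, Function.extend_apply' _ _ _ hk]
    · simp [Function.onFun, Function.extend_apply' _ _ _ hj]

variable [IsProbabilityMeasure P]

lemma lintegral_expNeg_mul (hG : IsCompletelyRandomMeasure P G ν) (hν : IsLevyMeasure ν) {A : Set S}
    (hA : MeasurableSet A) {c : ℝ≥0∞} (hc : c ≠ ∞) :
    ∫⁻ θ, expNeg (c * G θ A) ∂P =
      expNeg (∫⁻ p in Set.univ ×ˢ A, (1 - expNeg (c * p.1)) ∂ν) := by
  lift c to ℝ≥0 using hc
  have hmeas : Measurable fun θ => (G θ A).toNNReal :=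
    (Measure.measurable_coe hA).comp hG.measurable |>.ennreal_toNNReal
  rw [← lintegral_expNeg_mul_of_charFun_eq hmeas measurable_fst (hν.integrableOn_min hA)
    (hG.charFun_eq A hA) c]
  refine lintegral_congr_ae ?_
  filter_upwards [hG.finite A hA] with θ hθ
  rw [ENNReal.coe_toNNReal hθ.ne]

lemma lintegral_expNeg_lintegral_simpleFunc (hG : IsCompletelyRandomMeasure P G ν)
    (hν : IsLevyMeasure ν) (f : SimpleFunc S ℝ≥0∞) (hf : ∀ s, f s ≠ ∞) :
    ∫⁻ θ, expNeg (∫⁻ s, f s ∂(G θ)) ∂P =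
      expNeg (∫⁻ p, (1 - expNeg (p.1 * f p.2)) ∂ν) := by
  have hmeas (x : ℝ≥0∞) : Measurable fun θ => G θ (f ⁻¹' {x}) :=
    (Measure.measurable_coe (f.measurableSet_fiber x)).comp hG.measurable
  have hindep : iIndepFun (fun (x : f.range) θ => expNeg (x * G θ (f ⁻¹' {x.1}))) P :=
    (hG.iIndepFun_of_countable (fun x : f.range => f.measurableSet_fiber x)
      (fun x y hxy => (Set.disjoint_singleton.2 (Subtype.coe_injective.ne hxy)).preimage f)).comp
      (fun x y => expNeg (x * y)) (fun x => by fun_prop)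
  have hsplit (p : ℝ≥0 × S) : 1 - expNeg (p.1 * f p.2) = ∑ x ∈ f.range,
      (Set.univ ×ˢ (f ⁻¹' {x})).indicator (fun p : ℝ≥0 × S => 1 - expNeg (x * p.1)) p := by
    rw [Finset.sum_eq_single (f p.2) (fun x _ hx => by simp [hx.symm]) (by simp)]
    simp [mul_comm]
  calc ∫⁻ θ, expNeg (∫⁻ s, f s ∂(G θ)) ∂P
      = ∫⁻ θ, ∏ x : f.range, expNeg (x * G θ (f ⁻¹' {x.1})) ∂P := by
        refine lintegral_congr fun θ => ?_
        rw [SimpleFunc.lintegral_eq_lintegral, SimpleFunc.lintegral, expNeg_sum,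
          ← Finset.prod_coe_sort f.range]
    _ = ∏ x : f.range, expNeg
          (∫⁻ p in Set.univ ×ˢ (f ⁻¹' {x.1}), (1 - expNeg (x * p.1)) ∂ν) := by
        rw [lintegral_prod_eq_prod_lintegral_of_indepFun _ _ hindep
          fun x => by have := hmeas x; fun_prop]
        refine Finset.prod_congr rfl fun x _ => hG.lintegral_expNeg_mul hν
          (f.measurableSet_fiber x) ?_
        obtain ⟨s, hs⟩ := f.mem_range.1 x.2
        exact hs ▸ hf s
    _ = expNeg (∫⁻ p, (1 - expNeg (p.1 * f p.2)) ∂ν) := by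
        simp only [hsplit]
        rw [lintegral_finsetSum _ fun x _ => Measurable.indicator (by fun_prop)
          (MeasurableSet.univ.prod (f.measurableSet_fiber x)), expNeg_sum,
          ← Finset.prod_coe_sort f.range]
        simp only [lintegral_indicator (MeasurableSet.univ.prod (f.measurableSet_fiber _))]

theorem lintegral_expNeg_lintegral (hG : IsCompletelyRandomMeasure P G ν) (hν : IsLevyMeasure ν)
    {f : S → ℝ≥0∞} (hf : Measurable f) :
    ∫⁻ θ, expNeg (∫⁻ s, f s ∂(G θ)) ∂P = expNeg (∫⁻ p, (1 - expNeg (p.1 * f p.2)) ∂ν) := by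
  have hlim (s : S) : Filter.Tendsto (fun n => SimpleFunc.eapprox f n s) Filter.atTop
      (nhds (f s)) := by
    rw [← SimpleFunc.iSup_eapprox_apply hf s]
    exact tendsto_atTop_iSup fun m n hmn => SimpleFunc.monotone_eapprox f hmn s
  have hexp {m n : ℕ} (hmn : m ≤ n) (p : ℝ≥0 × S) :
      expNeg (p.1 * SimpleFunc.eapprox f n p.2) ≤ expNeg (p.1 * SimpleFunc.eapprox f m p.2) :=
    antitone_expNeg (mul_le_mul_right (SimpleFunc.monotone_eapprox f hmn p.2) _)
  refine tendsto_nhds_unique (tendsto_lintegral_expNeg (fun n => ?_) fun θ => ?_) ?_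
    (f := fun n => ∫⁻ θ, expNeg (∫⁻ s, SimpleFunc.eapprox f n s ∂(G θ)) ∂P)
  · exact (Measure.measurable_lintegral (SimpleFunc.measurable _)).comp hG.measurable
  · exact lintegral_tendsto_of_tendsto_of_monotone (fun n => (SimpleFunc.measurable _).aemeasurable)
      (.of_forall fun s m n hmn => SimpleFunc.monotone_eapprox f hmn s) (.of_forall hlim)
  · simp only [hG.lintegral_expNeg_lintegral_simpleFunc hν (SimpleFunc.eapprox f _)
      fun s => (SimpleFunc.eapprox_lt_top f _ s).ne]
    refine (continuous_expNeg.tendsto _).comp ?_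
    refine lintegral_tendsto_of_tendsto_of_monotone (fun n => by fun_prop)
      (.of_forall fun p m n hmn => tsub_le_tsub_left (hexp hmn p) 1) (.of_forall fun p => ?_)
    refine ENNReal.Tendsto.sub tendsto_const_nhds ((continuous_expNeg.tendsto _).comp ?_)
      (.inl ENNReal.one_ne_top)
    exact ENNReal.Tendsto.const_mul (hlim p.2) (.inr ENNReal.coe_ne_top)

end IsCompletelyRandomMeasure

end CompletelyRandom

lemma lintegral_pow_poissonMeasure (r : ℝ≥0) {y : ℝ≥0∞} (hy : y ≤ 1) :
    ∫⁻ j, y ^ j ∂(poissonMeasure r) = expNeg (r * (1 - y)) := by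
  lift y to ℝ≥0 using (hy.trans_lt ENNReal.one_lt_top).ne
  have hterm (j : ℕ) : (y : ℝ≥0∞) ^ j * poissonMeasure r {j} =
      ENNReal.ofReal (Real.exp (-r) * ((r * y) ^ j / j.factorial)) := by
    rw [poissonMeasure_singleton, ← ENNReal.ofReal_coe_nnreal,
      ← ENNReal.ofReal_pow y.coe_nonneg, ← ENNReal.ofReal_mul (by positivity)]
    congr 1
    ring
  have hsum : HasSum (fun j : ℕ => Real.exp (-r) * ((r * y : ℝ) ^ j / j.factorial))
      (Real.exp (-r) * Real.exp (r * y)) := by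
    refine HasSum.mul_left _ ?_
    rw [Real.exp_eq_exp_ℝ]
    exact NormedSpace.expSeries_div_hasSum_exp _
  have hexponent : (r : ℝ≥0∞) * (1 - y) = ENNReal.ofReal (r * (1 - y)) := by
    rw [ENNReal.ofReal_mul r.coe_nonneg, ENNReal.ofReal_sub _ y.coe_nonneg]
    simp
  have hy' : (y : ℝ) ≤ 1 := by exact_mod_cast hy
  rw [lintegral_countable', tsum_congr hterm,
    ← ENNReal.ofReal_tsum_of_nonneg (fun j => by positivity) hsum.summable, hsum.tsum_eq,
    hexponent, expNeg_ofReal (mul_nonneg r.coe_nonneg (sub_nonneg.2 hy')), ← Real.exp_add]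
  congr 2
  ring

lemma measurable_poissonMeasure : Measurable poissonMeasure := by
  refine Measure.measurable_of_measurable_coe _ fun s _ => ?_
  rw [show (fun x => poissonMeasure x s) = fun x => ∑' j : ℕ, s.indicator 1 j * poissonMeasure x {j}
    from funext fun x => by
      rw [← lintegral_countable', lintegral_indicator_one (.of_discrete)]]
  simp only [poissonMeasure_singleton]
  fun_prop

lemma lintegral_prod_infinitePi {ι : Type*} {X : ι → Type*} [∀ i, MeasurableSpace (X i)]
    (μ : ∀ i, Measure (X i)) [∀ i, IsProbabilityMeasure (μ i)] (s : Finset ι)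
    {h : ∀ i, X i → ℝ≥0∞} (hh : ∀ i, Measurable (h i)) :
    ∫⁻ x, ∏ i ∈ s, h i (x i) ∂(Measure.infinitePi μ) = ∏ i ∈ s, ∫⁻ x, h i x ∂(μ i) := by
  rw [lintegral_prod_eq_prod_lintegral_of_indepFun s _ (iIndepFun_infinitePi hh)
    fun i => (hh i).comp (measurable_pi_apply i)]
  exact Finset.prod_congr rfl fun i _ =>
    (measurePreserving_eval_infinitePi μ i).lintegral_comp (hh i)

section Conditional

/-- Conditional expectations are defined for real functions only, hence the conversions. -/
lemma lintegral_ofReal_condExp_indicator_mul {Θ : Type*} {m m₀ : MeasurableSpace Θ}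
    {P : Measure Θ} [IsFiniteMeasure P] (hm : m ≤ m₀) {E : Set Θ} (hE : MeasurableSet E)
    {g : Θ → ℝ≥0∞} (hg : Measurable[m] g) :
    ∫⁻ θ, ENNReal.ofReal ((P[E.indicator (fun _ => (1 : ℝ)) | m]) θ) * g θ ∂P =
      ∫⁻ θ in E, g θ ∂P := by
  set p := P[E.indicator (fun _ => (1 : ℝ)) | m]
  have hint : Integrable (E.indicator fun _ => (1 : ℝ)) P := (integrable_const 1).indicator hE
  have hp : Measurable[m] fun θ => ENNReal.ofReal (p θ) :=
    stronglyMeasurable_condExp.measurable.ennreal_ofReal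
  have hp0 : 0 ≤ᵐ[P] p := condExp_nonneg (.of_forall fun θ => Set.indicator_nonneg (by simp) θ)
  have htrim : (P.withDensity fun θ => ENNReal.ofReal (p θ)).trim hm = (P.restrict E).trim hm := by
    refine @Measure.ext _ m _ _ fun C hC => ?_
    rw [trim_measurableSet_eq hm hC, trim_measurableSet_eq hm hC, withDensity_apply _ (hm _ hC),
      Measure.restrict_apply (hm _ hC),
      ← ofReal_integral_eq_lintegral_ofReal integrable_condExp.integrableOn (ae_restrict_of_ae hp0),
      setIntegral_condExp hm hint hC, integral_indicator hE, Measure.restrict_restrict hE,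
      Set.inter_comm]
    simp
  rw [← lintegral_trim hm hg, ← htrim, lintegral_trim hm hg,
    lintegral_withDensity_eq_lintegral_mul _ (hp.mono hm le_rfl) (hg.mono hm le_rfl)]
  rfl

/-- The sigma-algebra generated by the weights and atoms, on which the counts are conditioned. -/
abbrev weightAtomSigma {S Θ : Type*} [MeasurableSpace S] (r : ℕ → Θ → ℝ≥0)
    (ω : ℕ → Θ → S) : MeasurableSpace Θ :=
  MeasurableSpace.comap (fun θ k => (r k θ, ω k θ)) inferInstance

lemma measurable_weightAtomSigma {S Θ : Type*} [MeasurableSpace S] (r : ℕ → Θ → ℝ≥0)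
    (ω : ℕ → Θ → S) (k : ℕ) :
    Measurable[weightAtomSigma r ω] fun θ => (r k θ, ω k θ) := by
  have hpair : Measurable[weightAtomSigma r ω] fun θ k => (r k θ, ω k θ) := comap_measurable _
  exact (measurable_pi_apply k).comp hpair

variable {S Θ : Type*} [MeasurableSpace S] [MeasurableSpace Θ] {P : Measure Θ}
  {ν : Measure (ℝ≥0 × S)} {r : ℕ → Θ → ℝ≥0} {ω : ℕ → Θ → S} {n : ℕ → Θ → ℕ}

lemma lintegral_atomic (w : ℕ → ℝ≥0∞) (x : ℕ → S) {g : S → ℝ≥0∞} (hg : Measurable g) :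
    ∫⁻ s, g s ∂(atomic w x) = ∑' k, w k * g (x k) := by
  simp only [atomic, lintegral_sum_measure, lintegral_smul_measure, lintegral_dirac' _ hg,
    smul_eq_mul]

namespace IsCountMixtureModel

lemma weightAtomSigma_le (h : IsCountMixtureModel P ν r ω n) :
    weightAtomSigma r ω ≤ ‹MeasurableSpace Θ› :=
  Measurable.comap_le <| measurable_pi_lambda _ fun k =>
    (h.measurable_weight k).prodMk (h.measurable_atom k)

variable [IsProbabilityMeasure P]

lemma setLIntegral_counts (h : IsCountMixtureModel P ν r ω n) {s : Finset ℕ} (j : s → ℕ)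
    {g : Θ → ℝ≥0∞} (hg : Measurable[weightAtomSigma r ω] g) :
    ∫⁻ θ in (fun θ (k : s) => n k θ) ⁻¹' {j}, g θ ∂P =
      ∫⁻ θ, Measure.pi (fun k : s => poissonMeasure (r k θ)) {j} * g θ ∂P := by
  have hn : Measurable fun θ (k : s) => n k θ :=
    measurable_pi_lambda _ fun k => h.measurable_count k
  have hset : {θ | ∀ k ∈ s, n k θ = Function.extend Subtype.val j 0 k} =
      (fun θ (k : s) => n k θ) ⁻¹' {j} := by
    ext θ
    have hj (k : s) : Function.extend Subtype.val j 0 (k : ℕ) = j k :=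
      Subtype.val_injective.extend_apply j 0 k
    simp only [Set.mem_ofPred_eq, Set.mem_preimage, Set.mem_singleton_iff, funext_iff, ← hj]
    exact ⟨fun H k => H k k.2, fun H k hk => H ⟨k, hk⟩⟩
  have hcond := h.count_condLaw s (Function.extend Subtype.val j 0)
  rw [hset] at hcond
  rw [← lintegral_ofReal_condExp_indicator_mul h.weightAtomSigma_le
      (hn (measurableSet_singleton j)) hg]
  refine lintegral_congr_ae ?_
  filter_upwards [hcond] with θ hθ
  rw [hθ, Measure.pi_singleton, ENNReal.ofReal_prod_of_nonneg fun _ _ => measureReal_nonneg,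
    ← Finset.prod_coe_sort s]
  simp

lemma lintegral_counts (h : IsCountMixtureModel P ν r ω n) {s : Finset ℕ}
    {g : (s → ℕ) → Θ → ℝ≥0∞} (hg : ∀ j, Measurable[weightAtomSigma r ω] (g j)) :
    ∫⁻ θ, g (fun k => n k θ) θ ∂P =
      ∫⁻ θ, ∫⁻ j, g j θ ∂(Measure.pi fun k : s => poissonMeasure (r k θ)) ∂P := by
  have hn : Measurable fun θ (k : s) => n k θ :=
    measurable_pi_lambda _ fun k => h.measurable_count k
  have hpartition : (⋃ j, (fun θ (k : s) => n k θ) ⁻¹' {j}) = Set.univ := by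
    ext θ
    simp
  have hpi (j : s → ℕ) :
      Measurable fun θ => Measure.pi (fun k : s => poissonMeasure (r k θ)) {j} := by
    simp only [Measure.pi_singleton]
    exact Finset.measurable_prod _ fun k _ =>
      (Measure.measurable_coe (measurableSet_singleton (j k))).comp
        (measurable_poissonMeasure.comp (h.measurable_weight k))
  calc ∫⁻ θ, g (fun k => n k θ) θ ∂P
      = ∑' j, ∫⁻ θ in (fun θ (k : s) => n k θ) ⁻¹' {j}, g j θ ∂P := by
        rw [← setLIntegral_univ, ← hpartition, lintegral_iUnion
          (fun j => hn (measurableSet_singleton j))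
          fun i j hij => (Set.disjoint_singleton.2 hij).preimage _]
        exact tsum_congr fun j => setLIntegral_congr_fun (hn (measurableSet_singleton j))
          fun θ (hθ : (fun k : s => n k θ) = j) => by rw [hθ]
    _ = ∑' j, ∫⁻ θ, g j θ * Measure.pi (fun k : s => poissonMeasure (r k θ)) {j} ∂P :=
        tsum_congr fun j => by simp only [h.setLIntegral_counts j (hg j), mul_comm]
    _ = ∫⁻ θ, ∫⁻ j, g j θ ∂(Measure.pi fun k : s => poissonMeasure (r k θ)) ∂P := by
        simp only [lintegral_countable']
        exact (lintegral_tsum fun j =>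
          (((hg j).mono h.weightAtomSigma_le le_rfl).mul (hpi j)).aemeasurable).symm

theorem lintegral_expNeg_countMeasure (h : IsCountMixtureModel P ν r ω n) {f : S → ℝ≥0∞}
    (hf : Measurable f) :
    ∫⁻ θ, expNeg (∫⁻ s, f s ∂(countMeasure ω n θ)) ∂P =
      ∫⁻ θ, expNeg (∫⁻ s, (1 - expNeg (f s))
        ∂(atomic (fun k => (r k θ : ℝ≥0∞)) fun k => ω k θ)) ∂P := by
  have hn (k : ℕ) : Measurable fun θ => (n k θ : ℝ≥0∞) :=
    Measurable.of_discrete.comp (h.measurable_count k)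
  have hω := h.measurable_atom
  have hr := h.measurable_weight
  have hpartial (s : Finset ℕ) : ∫⁻ θ, expNeg (∑ k ∈ s, n k θ * f (ω k θ)) ∂P =
      ∫⁻ θ, expNeg (∑ k ∈ s, r k θ * (1 - expNeg (f (ω k θ)))) ∂P := by
    simp only [expNeg_sum, expNeg_natCast_mul, ← Finset.prod_coe_sort s]
    rw [h.lintegral_counts (g := fun j θ => ∏ k : s, expNeg (f (ω k θ)) ^ j k) fun j =>
      Finset.measurable_prod _ fun k _ => (measurable_expNeg.comp (hf.comp
        (measurable_snd.comp (measurable_weightAtomSigma r ω k)))).pow_const _]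
    refine lintegral_congr fun θ => ?_
    rw [← Measure.infinitePi_eq_pi, lintegral_prod_infinitePi _ Finset.univ
      (h := fun (k : s) j => expNeg (f (ω k θ)) ^ j) fun _ => .of_discrete]
    exact Finset.prod_congr rfl fun k _ => lintegral_pow_poissonMeasure _ (expNeg_le_one _)
  simp only [countMeasure, lintegral_atomic _ _ hf,
    lintegral_atomic _ _ (show Measurable fun s => 1 - expNeg (f s) by fun_prop)]
  refine tendsto_nhds_unique (tendsto_lintegral_expNeg (fun N => ?_) fun θ =>
    ENNReal.summable.hasSum.tendsto_sum_nat) ?_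
  · exact Finset.measurable_sum _ fun k _ => (hn k).mul (hf.comp (hω k))
  · simp only [hpartial]
    exact tendsto_lintegral_expNeg (fun N => by fun_prop) fun θ =>
      ENNReal.summable.hasSum.tendsto_sum_nat

end IsCountMixtureModel

end Conditional

section CompoundPoisson

variable {S : Type*} [MeasurableSpace S]

/-- The law of the data of a compound Poisson process: a number of clusters with law
`Pois(lam)` and, independently, a sequence of iid sizes and locations with law `q × g`. -/
def compoundLaw (lam : ℝ≥0) (q : Measure ℕ) (g : Measure S) : Measure (ℕ × (ℕ → ℕ × S)) :=
  (poissonMeasure lam).prod (Measure.infinitePi fun _ => q.prod g)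

/-- The random measure built from a number of clusters `x.1` and a sequence `x.2` of sizes and
locations, of which only the first `x.1` terms are used. -/
def compoundMeasure (x : ℕ × (ℕ → ℕ × S)) : Measure S :=
  ∑ k ∈ Finset.range x.1, ((x.2 k).1 : ℝ≥0∞) • Measure.dirac (x.2 k).2

lemma lintegral_compoundMeasure (x : ℕ × (ℕ → ℕ × S)) {f : S → ℝ≥0∞} (hf : Measurable f) :
    ∫⁻ s, f s ∂(compoundMeasure x) =
      ∑ k ∈ Finset.range x.1, ((x.2 k).1 : ℝ≥0∞) * f (x.2 k).2 := by
  simp only [compoundMeasure, lintegral_finsetSum_measure, lintegral_smul_measure,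
    lintegral_dirac' _ hf, smul_eq_mul]

lemma measurable_natCast_mul_comp {f : S → ℝ≥0∞} (hf : Measurable f) :
    Measurable fun p : ℕ × S => (p.1 : ℝ≥0∞) * f p.2 :=
  (Measurable.of_discrete.comp measurable_fst).mul (hf.comp measurable_snd)

lemma measurable_compoundMeasure : Measurable (compoundMeasure (S := S)) := by
  refine Measure.measurable_of_measurable_coe _ fun A hA => ?_
  have hind : Measurable (A.indicator (1 : S → ℝ≥0∞)) := measurable_one.indicator hA
  simp only [← lintegral_indicator_one hA, lintegral_compoundMeasure _ hind]
  exact measurable_from_prod_countable_right fun l => Finset.measurable_sum (.range l) fun k _ =>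
    (measurable_natCast_mul_comp hind).comp (measurable_pi_apply k)

lemma lintegral_prod_range_poissonMeasure_prod_infinitePi {E : Type*} [MeasurableSpace E]
    (lam : ℝ≥0) (π : Measure E) [IsProbabilityMeasure π] {h : E → ℝ≥0∞} (hh : Measurable h)
    (h1 : ∀ y, h y ≤ 1) :
    ∫⁻ x, ∏ k ∈ Finset.range x.1, h (x.2 k)
        ∂((poissonMeasure lam).prod (Measure.infinitePi fun _ : ℕ => π)) =
      expNeg (lam * ∫⁻ y, (1 - h y) ∂π) := by
  have hle : ∫⁻ y, h y ∂π ≤ 1 := (lintegral_mono h1).trans (by simp)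
  have hmeas : Measurable fun x : ℕ × (ℕ → E) => ∏ k ∈ Finset.range x.1, h (x.2 k) :=
    measurable_from_prod_countable_right fun l => Finset.measurable_prod (.range l) fun k _ =>
      hh.comp (measurable_pi_apply k)
  rw [lintegral_prod _ hmeas.aemeasurable, lintegral_sub hh (hle.trans_lt ENNReal.one_lt_top).ne
    (.of_forall h1), lintegral_one, measure_univ, ← lintegral_pow_poissonMeasure lam hle]
  refine lintegral_congr fun l => ?_
  refine (lintegral_prod_infinitePi (fun _ => π) (Finset.range l) fun _ => hh).trans ?_
  simp

theorem lintegral_expNeg_compoundMeasure (lam : ℝ≥0) (q : Measure ℕ) [IsProbabilityMeasure q]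
    (g : Measure S) [IsProbabilityMeasure g] {f : S → ℝ≥0∞} (hf : Measurable f) :
    ∫⁻ x, expNeg (∫⁻ s, f s ∂(compoundMeasure x)) ∂(compoundLaw lam q g) =
      expNeg (lam * ∫⁻ p, (1 - expNeg (p.1 * f p.2)) ∂(q.prod g)) := by
  simp only [lintegral_compoundMeasure _ hf, expNeg_sum]
  exact lintegral_prod_range_poissonMeasure_prod_infinitePi lam _
    (measurable_expNeg.comp (measurable_natCast_mul_comp hf)) fun _ => expNeg_le_one _

end CompoundPoisson

section Sizes

variable {ρ : Measure ℝ≥0}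

lemma pow_mul_exp_neg_le {j : ℕ} (hj : j ≠ 0) (x : ℝ≥0) :
    (x : ℝ) ^ j * Real.exp (-x) ≤ j.factorial * (1 - Real.exp (-x)) := by
  have hcompl : (poissonMeasure x).real {0}ᶜ = 1 - Real.exp (-x) := by
    rw [probReal_compl_eq_one_sub (measurableSet_singleton 0), poissonMeasure_real_singleton]
    simp
  have hle : (poissonMeasure x).real {j} ≤ (poissonMeasure x).real {0}ᶜ :=
    measureReal_mono (by simpa using hj.symm)
  rw [hcompl, poissonMeasure_real_singleton, div_le_iff₀ (by positivity)] at hle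
  linarith

lemma integrable_pow_mul_exp_neg (hρ : Integrable (fun x : ℝ≥0 => 1 - Real.exp (-x)) ρ) {j : ℕ}
    (hj : j ≠ 0) : Integrable (fun x : ℝ≥0 => (x : ℝ) ^ j * Real.exp (-x)) ρ := by
  refine (hρ.const_mul (j.factorial : ℝ)).mono' (by fun_prop) (.of_forall fun x => ?_)
  rw [Real.norm_of_nonneg (by positivity)]
  exact pow_mul_exp_neg_le hj x

lemma integral_one_sub_exp_neg_pos (hρ : Integrable (fun x : ℝ≥0 => 1 - Real.exp (-x)) ρ)
    (h0 : ρ {0}ᶜ ≠ 0) : 0 < ∫ x : ℝ≥0, (1 - Real.exp (-x)) ∂ρ := by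
  have hsupp : Function.support (fun x : ℝ≥0 => 1 - Real.exp (-x)) = {0}ᶜ := by
    ext x
    simp [sub_eq_zero, eq_comm (a := (1 : ℝ))]
  rw [integral_pos_iff_support_of_nonneg (fun x => by simp) hρ, hsupp]
  exact pos_iff_ne_zero.2 h0

lemma sizeLaw_singleton_zero : sizeLaw ρ {0} = 0 := by
  simp [sizeLaw]

lemma sizeLaw_singleton_succ (i : ℕ) :
    sizeLaw ρ {i + 1} = ENNReal.ofReal (sizeProb ρ (i + 1)) := by
  rw [sizeLaw, Measure.sum_apply _ (measurableSet_singleton _), tsum_eq_single i]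
  · simp
  · intro j hj
    simp [hj]

/-- The cluster sizes are the positive counts of a Poisson mixture, whose mixing measure `ρ` may be
infinite. -/
lemma ofReal_integral_smul_sizeLaw (hρ : Integrable (fun x : ℝ≥0 => 1 - Real.exp (-x)) ρ)
    (h0 : ρ {0}ᶜ ≠ 0) :
    ENNReal.ofReal (∫ x : ℝ≥0, (1 - Real.exp (-x)) ∂ρ) • sizeLaw ρ =
      (ρ.bind poissonMeasure).restrict {0}ᶜ := by
  have hpos := integral_one_sub_exp_neg_pos hρ h0
  refine Measure.ext_iff_singleton.2 fun j => ?_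
  rw [Measure.smul_apply, smul_eq_mul, Measure.restrict_apply (measurableSet_singleton j)]
  cases j with
  | zero => simp [sizeLaw_singleton_zero]
  | succ i =>
    have hint := (integrable_pow_mul_exp_neg hρ i.succ_ne_zero).div_const ((i + 1).factorial : ℝ)
    have hpoisson (x : ℝ≥0) : poissonMeasure x {i + 1} =
        ENNReal.ofReal ((x : ℝ) ^ (i + 1) * Real.exp (-x) / (i + 1).factorial) := by
      rw [poissonMeasure_singleton, mul_comm (Real.exp _)]
    rw [Set.inter_eq_left.2 (by simp), Measure.bind_apply (measurableSet_singleton _)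
      measurable_poissonMeasure.aemeasurable, sizeLaw_singleton_succ, ← ENNReal.ofReal_mul hpos.le]
    simp only [hpoisson]
    rw [← ofReal_integral_eq_lintegral_ofReal hint (.of_forall fun x => by positivity),
      integral_div, sizeProb]
    congr 1
    field_simp

lemma isProbabilityMeasure_sizeLaw (hρ : Integrable (fun x : ℝ≥0 => 1 - Real.exp (-x)) ρ)
    (h0 : ρ {0}ᶜ ≠ 0) : IsProbabilityMeasure (sizeLaw ρ) := by
  have hpoisson (x : ℝ≥0) : poissonMeasure x {0}ᶜ = ENNReal.ofReal (1 - Real.exp (-x)) := by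
    rw [prob_compl_eq_one_sub (measurableSet_singleton 0), poissonMeasure_singleton,
      ← one_sub_expNeg_coe, expNeg_coe]
    simp
  have hmass : ENNReal.ofReal (∫ x : ℝ≥0, (1 - Real.exp (-x)) ∂ρ) * sizeLaw ρ Set.univ =
      ENNReal.ofReal (∫ x : ℝ≥0, (1 - Real.exp (-x)) ∂ρ) := by
    rw [← smul_eq_mul, ← Measure.smul_apply, ofReal_integral_smul_sizeLaw hρ h0,
      Measure.restrict_apply_univ, Measure.bind_apply (measurableSet_singleton 0).compl
        measurable_poissonMeasure.aemeasurable,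
      ofReal_integral_eq_lintegral_ofReal hρ (.of_forall fun x => by simp)]
    simp only [hpoisson]
  exact ⟨(ENNReal.mul_eq_left
    (ENNReal.ofReal_pos.2 (integral_one_sub_exp_neg_pos hρ h0)).ne' ENNReal.ofReal_ne_top).1 hmass⟩

variable {S : Type*} [MeasurableSpace S] {G₀ : Measure S}

lemma IsLevyMeasure.integrable_one_sub_exp_neg [SFinite G₀] (hν : IsLevyMeasure (ρ.prod G₀))
    (hG₀ : G₀ ≠ 0) : Integrable (fun x : ℝ≥0 => 1 - Real.exp (-x)) ρ := by
  have hmul : (∫⁻ x : ℝ≥0, min 1 (x : ℝ≥0∞) ∂ρ) * G₀ Set.univ < ∞ := by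
    have hfin := hν Set.univ MeasurableSet.univ
    rw [Set.univ_prod_univ, setLIntegral_univ, lintegral_prod _ (by fun_prop)] at hfin
    simpa only [lintegral_const, lintegral_mul_const _
      (show Measurable fun x : ℝ≥0 => min 1 (x : ℝ≥0∞) by fun_prop)] using hfin
  have hmin : Integrable (fun x : ℝ≥0 => min 1 (x : ℝ)) ρ := by
    refine ⟨by fun_prop, ?_⟩
    rw [hasFiniteIntegral_iff_ofReal (.of_forall fun x => by positivity)]
    simpa using ENNReal.lt_top_of_mul_ne_top_left hmul.ne (by simpa using hG₀)
  simpa using integrable_one_sub_exp_neg_mul measurable_id hmin 1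

variable [IsFiniteMeasure G₀]

lemma isProbabilityMeasure_baseLaw (hG₀ : G₀ ≠ 0) : IsProbabilityMeasure (baseLaw G₀) := by
  constructor
  rw [baseLaw, Measure.smul_apply, smul_eq_mul]
  exact ENNReal.inv_mul_cancel (by simpa using hG₀) (measure_ne_top _ _)

lemma measure_univ_smul_baseLaw (hG₀ : G₀ ≠ 0) : G₀ Set.univ • baseLaw G₀ = G₀ := by
  rw [baseLaw, smul_smul, ENNReal.mul_inv_cancel (by simpa using hG₀) (measure_ne_top _ _),
    one_smul]

lemma coe_clusterRate :
    (clusterRate ρ G₀ : ℝ≥0∞) =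
      ENNReal.ofReal (∫ x : ℝ≥0, (1 - Real.exp (-x)) ∂ρ) * G₀ Set.univ := by
  rw [clusterRate, ← ENNReal.ofReal, ENNReal.ofReal_mul measureReal_nonneg, ofReal_measureReal,
    mul_comm]

lemma coe_clusterRate_mul_lintegral_sizeLaw_prod_baseLaw
    (hρ : Integrable (fun x : ℝ≥0 => 1 - Real.exp (-x)) ρ) (h0 : ρ {0}ᶜ ≠ 0) (hG₀ : G₀ ≠ 0)
    {F : ℕ × S → ℝ≥0∞} (hF : Measurable F) (hF0 : ∀ s, F (0, s) = 0) :
    clusterRate ρ G₀ * ∫⁻ p, F p ∂((sizeLaw ρ).prod (baseLaw G₀)) =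
      ∫⁻ x, ∫⁻ s, ∫⁻ j, F (j, s) ∂(poissonMeasure x) ∂G₀ ∂ρ := by
  have := isProbabilityMeasure_sizeLaw hρ h0
  have := isProbabilityMeasure_baseLaw hG₀
  have hsupp : Function.support (fun j => ∫⁻ s, F (j, s) ∂G₀) ⊆ {0}ᶜ := by
    rw [Function.support_subset_iff']
    rintro j hj
    obtain rfl : j = 0 := by simpa using hj
    simp [hF0]
  calc clusterRate ρ G₀ * ∫⁻ p, F p ∂((sizeLaw ρ).prod (baseLaw G₀))
      = ∫⁻ p, F p ∂((ENNReal.ofReal (∫ x : ℝ≥0, (1 - Real.exp (-x)) ∂ρ) • sizeLaw ρ).prod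
          (G₀ Set.univ • baseLaw G₀)) := by
        rw [Measure.prod_smul_left, Measure.prod_smul_right, lintegral_smul_measure,
          lintegral_smul_measure, coe_clusterRate, smul_eq_mul, smul_eq_mul, mul_assoc]
    _ = ∫⁻ j, ∫⁻ s, F (j, s) ∂G₀ ∂(ρ.bind poissonMeasure) := by
        rw [ofReal_integral_smul_sizeLaw hρ h0, measure_univ_smul_baseLaw hG₀,
          lintegral_prod _ hF.aemeasurable, setLIntegral_eq_of_support_subset hsupp]
    _ = ∫⁻ x, ∫⁻ s, ∫⁻ j, F (j, s) ∂(poissonMeasure x) ∂G₀ ∂ρ := by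
        rw [Measure.lintegral_bind measurable_poissonMeasure.aemeasurable
          hF.lintegral_prod_right'.aemeasurable]
        exact lintegral_congr fun x => lintegral_lintegral_swap hF.aemeasurable

theorem lintegral_expNeg_compoundMeasure_clusterRate
    (hρ : Integrable (fun x : ℝ≥0 => 1 - Real.exp (-x)) ρ) (h0 : ρ {0}ᶜ ≠ 0) (hG₀ : G₀ ≠ 0)
    {f : S → ℝ≥0∞} (hf : Measurable f) :
    ∫⁻ x, expNeg (∫⁻ s, f s ∂(compoundMeasure x))
        ∂(compoundLaw (clusterRate ρ G₀) (sizeLaw ρ) (baseLaw G₀)) =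
      expNeg (∫⁻ p, (1 - expNeg (p.1 * (1 - expNeg (f p.2)))) ∂(ρ.prod G₀)) := by
  have := isProbabilityMeasure_sizeLaw hρ h0
  have := isProbabilityMeasure_baseLaw hG₀
  have hgen (x : ℝ≥0) (s : S) : ∫⁻ j : ℕ, (1 - expNeg (j * f s)) ∂(poissonMeasure x) =
      1 - expNeg (x * (1 - expNeg (f s))) := by
    have hpow := lintegral_pow_poissonMeasure x (expNeg_le_one (f s))
    simp only [← expNeg_natCast_mul] at hpow
    rw [lintegral_sub .of_discrete (hpow ▸ ne_top_of_le_ne_top ENNReal.one_ne_top (expNeg_le_one _))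
      (.of_forall fun j => expNeg_le_one _), hpow]
    simp
  rw [lintegral_expNeg_compoundMeasure _ _ _ hf,
    coe_clusterRate_mul_lintegral_sizeLaw_prod_baseLaw hρ h0 hG₀
      (F := fun p => 1 - expNeg (p.1 * f p.2))
      (measurable_const.sub (measurable_expNeg.comp (measurable_natCast_mul_comp hf)))
      (by simp)]
  simp only [hgen]
  rw [lintegral_prod _ (by fun_prop)]

end Sizes

section Uniqueness

open BoundedContinuousFunction

lemma expNeg_injective : Function.Injective expNeg := fun _ _ h =>
  EReal.coe_ennreal_injective (neg_injective (EReal.exp_strictMono.injective h))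

lemma expNeg_ne_top (x : ℝ≥0∞) : expNeg x ≠ ∞ :=
  ((expNeg_le_one x).trans_lt ENNReal.one_lt_top).ne

variable {ι : Type*} [Fintype ι]

/-- The functions `x ↦ exp (-∑ i, k i * x i)` on `[0, ∞]^ι` with `k i ∈ ℕ`, as a monoid
homomorphism in `k`. They span an algebra of continuous functions that separates points. -/
def expNegSum : Multiplicative (ι → ℕ) →* ((ι → ℝ≥0∞) →ᵇ ℝ) where
  toFun k := BoundedContinuousFunction.ofNormedAddCommGroup
    (fun x => (expNeg (∑ i, k.toAdd i * x i)).toReal)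
    (ENNReal.continuousOn_toReal.comp_continuous
      (continuous_expNeg.comp (continuous_finsetSum _ fun i _ =>
        (ENNReal.continuous_const_mul (ENNReal.natCast_ne_top _)).comp (continuous_apply i)))
      fun _ => expNeg_ne_top _) 1
    fun x => by
      rw [Real.norm_of_nonneg ENNReal.toReal_nonneg]
      exact ENNReal.toReal_mono ENNReal.one_ne_top (expNeg_le_one _)
  map_one' := by
    ext x
    simp
  map_mul' k l := by
    ext x
    simp [add_mul, Finset.sum_add_distrib, expNeg_add]

lemma expNegSum_apply (k : Multiplicative (ι → ℕ)) (x : ι → ℝ≥0∞) :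
    expNegSum k x = (expNeg (∑ i, k.toAdd i * x i)).toReal := rfl

/-- The algebra spanned by the functions `expNegSum k`. -/
def expNegAlgebra (ι : Type*) [Fintype ι] : StarSubalgebra ℝ ((ι → ℝ≥0∞) →ᵇ ℝ) where
  __ := Algebra.adjoin ℝ (MonoidHom.mrange (expNegSum (ι := ι)))
  star_mem' {a} ha := by
    rwa [show star a = a by ext; simp]

lemma separatesPoints_expNegAlgebra :
    ((expNegAlgebra ι).map (toContinuousMapStarₐ ℝ)).SeparatesPoints := by
  classical
  intro x y hxy
  obtain ⟨i, hi⟩ := Function.ne_iff.1 hxy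
  have hcoord (z : ι → ℝ≥0∞) :
      expNegSum (.ofAdd (Pi.single i 1)) z = (expNeg (z i)).toReal := by
    simp [expNegSum_apply, Pi.single_apply]
  refine ⟨_, ⟨_, ⟨expNegSum (.ofAdd (Pi.single i 1)), Algebra.subset_adjoin ⟨_, rfl⟩, rfl⟩, rfl⟩,
    fun h => hi (expNeg_injective ?_)⟩
  rw [← ENNReal.toReal_eq_toReal_iff' (expNeg_ne_top _) (expNeg_ne_top _), ← hcoord, ← hcoord]
  exact h

theorem measure_ext_of_lintegral_expNeg_sum {μ ν : Measure (ι → ℝ≥0∞)} [IsFiniteMeasure μ]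
    [IsFiniteMeasure ν]
    (h : ∀ k : ι → ℕ, ∫⁻ x, expNeg (∑ i, k i * x i) ∂μ = ∫⁻ x, expNeg (∑ i, k i * x i) ∂ν) :
    μ = ν := by
  refine ext_of_forall_mem_subalgebra_integral_eq_of_polish separatesPoints_expNegAlgebra
    fun g hg => ?_
  have hspan : g ∈ Submodule.span ℝ
      (MonoidHom.mrange (expNegSum (ι := ι)) : Set ((ι → ℝ≥0∞) →ᵇ ℝ)) := by
    rw [← Submonoid.closure_eq (MonoidHom.mrange _), ← Algebra.adjoin_eq_span]
    exact hg
  clear hg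
  induction hspan using Submodule.span_induction with
  | mem g hg =>
    obtain ⟨k, rfl⟩ := hg
    have hmeas : Measurable fun x : ι → ℝ≥0∞ => expNeg (∑ i, k.toAdd i * x i) := by fun_prop
    simp only [expNegSum_apply]
    rw [integral_toReal hmeas.aemeasurable (.of_forall fun x => (expNeg_ne_top _).lt_top),
      integral_toReal hmeas.aemeasurable (.of_forall fun x => (expNeg_ne_top _).lt_top), h]
  | zero => simp
  | add g g' _ _ ih ih' =>
    simp only [BoundedContinuousFunction.coe_add, Pi.add_apply]
    rw [integral_add (g.integrable _) (g'.integrable _),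
      integral_add (g.integrable _) (g'.integrable _), ih, ih']
  | smul c g _ ih =>
    simp only [BoundedContinuousFunction.coe_smul]
    rw [integral_smul, integral_smul, ih]

variable {S : Type*} [MeasurableSpace S]

lemma instMeasurableSpace_measure_eq_comap :
    (Measure.instMeasurableSpace : MeasurableSpace (Measure S)) =
      MeasurableSpace.comap (fun m (A : {A : Set S // MeasurableSet A}) => m A.1)
        inferInstance := by
  change (⨆ (s : Set S) (_ : MeasurableSet s), _) = MeasurableSpace.comap _ (⨆ _, _)
  simp only [MeasurableSpace.comap_iSup, iSup_subtype', MeasurableSpace.comap_comp]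
  rfl

lemma measure_ext_of_finiteDimensional {μ ν : Measure (Measure S)} [IsFiniteMeasure μ]
    (h : ∀ I : Finset {A : Set S // MeasurableSet A},
      μ.map (fun m (A : I) => m A.1.1) = ν.map fun m (A : I) => m A.1.1) : μ = ν := by
  set eval : Measure S → {A : Set S // MeasurableSet A} → ℝ≥0∞ := fun m A => m A.1
  have heval : Measurable eval := measurable_pi_lambda _ fun A => Measure.measurable_coe A.2
  have hmap (I : Finset {A : Set S // MeasurableSet A}) (μ : Measure (Measure S)) :
      (μ.map eval).map I.restrict = μ.map fun m (A : I) => m A.1.1 :=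
    Measure.map_map (Finset.measurable_restrict I) heval
  have hlimit : μ.map eval = ν.map eval :=
    IsProjectiveLimit.unique (P := fun I => (μ.map eval).map I.restrict) (fun I => rfl)
      fun I => by simp only [hmap, h]
  ext C hC
  rw [instMeasurableSpace_measure_eq_comap] at hC
  obtain ⟨D, hD, rfl⟩ := hC
  rw [← Measure.map_apply heval hD, hlimit, Measure.map_apply heval hD]

theorem measure_ext_of_laplaceFunctional {μ ν : Measure (Measure S)} [IsFiniteMeasure μ]
    [IsFiniteMeasure ν]
    (h : ∀ f : S → ℝ≥0∞, Measurable f →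
      ∫⁻ m, expNeg (∫⁻ s, f s ∂m) ∂μ = ∫⁻ m, expNeg (∫⁻ s, f s ∂m) ∂ν) : μ = ν := by
  refine measure_ext_of_finiteDimensional fun I => measure_ext_of_lintegral_expNeg_sum fun k => ?_
  have heval : Measurable fun (m : Measure S) (A : I) => m A.1.1 :=
    measurable_pi_lambda _ fun A => Measure.measurable_coe A.1.2
  have hind (A : I) : Measurable (A.1.1.indicator (1 : S → ℝ≥0∞)) :=
    measurable_one.indicator A.1.2
  have hsum (m : Measure S) : ∑ A : I, k A * m A.1.1 =
      ∫⁻ s, ∑ A : I, k A * A.1.1.indicator (1 : S → ℝ≥0∞) s ∂m := by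
    rw [lintegral_finsetSum _ fun A _ => (hind A).const_mul _]
    exact Finset.sum_congr rfl fun A _ => by
      rw [lintegral_const_mul _ (hind A), lintegral_indicator_one A.1.2]
  rw [lintegral_map (by fun_prop) heval, lintegral_map (by fun_prop) heval]
  simp only [hsum]
  exact h _ (Finset.measurable_sum _ fun A _ => (hind A).const_mul _)

end Uniqueness

section Clusters

variable {S : Type*}

/-- The first `m` terms of the code `e s` of a point `s`. For measurable `e`, the fibres of this map
are the cells of a finite measurable partition of the space, which gets finer as `m` grows. -/
def prefixCode (e : S → ℕ → Bool) (m : ℕ) (s : S) : Fin m → Bool :=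
  fun i => e s i

lemma exists_injOn_prefixCode {e : S → ℕ → Bool} (hinj : Function.Injective e) {t : Set S}
    (ht : t.Finite) : ∃ m, Set.InjOn (prefixCode e m) t := by
  have hpair (s s' : S) : ∀ᶠ m in Filter.atTop, prefixCode e m s = prefixCode e m s' → s = s' := by
    by_cases hs : s = s'
    · exact .of_forall fun _ _ => hs
    obtain ⟨i, hi⟩ := Function.ne_iff.1 (hinj.ne hs)
    filter_upwards [Filter.eventually_gt_atTop i] with m hm h
    exact absurd (congrFun h ⟨i, hm⟩) hi
  exact ((Filter.eventually_all_finite ht).2 fun s _ =>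
    (Filter.eventually_all_finite ht).2 fun s' _ => hpair s s').exists.imp
      fun m hm s hs s' hs' => hm s hs s' hs'

variable [MeasurableSpace S]

lemma measurable_prefixCode {e : S → ℕ → Bool} (he : Measurable e) (m : ℕ) :
    Measurable (prefixCode e m) :=
  measurable_pi_lambda _ fun i => (measurable_pi_apply (i : ℕ)).comp he

/-- The supremum over `m` of the number of cells of the partition given by `prefixCode e m` that a
measure charges. For injective `e` and an atomic measure this is the number of atoms, but unlike
the latter it is visibly a measurable function of the measure. -/
def clusterCount (e : S → ℕ → Bool) (μ : Measure S) : ℕ∞ :=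
  ⨆ m, {c | μ (prefixCode e m ⁻¹' {c}) ≠ 0}.encard

lemma measurable_clusterCount {e : S → ℕ → Bool} (he : Measurable e) :
    Measurable (clusterCount e) := by
  have : BorelSpace ℕ∞ := ⟨borel_eq_top_of_countable.symm⟩
  refine .iSup fun m => measurable_encard.comp (measurable_set_iff.2 fun c => ?_)
  have hcell : Measurable fun μ : Measure S => μ (prefixCode e m ⁻¹' {c}) :=
    Measure.measurable_coe (measurable_prefixCode he m (measurableSet_singleton c))
  exact measurableSet_setOfPred.1 (hcell (measurableSet_singleton 0).compl)

lemma atomic_ne_zero_iff (w : ℕ → ℝ≥0∞) (x : ℕ → S) {A : Set S} (hA : MeasurableSet A) :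
    atomic w x A ≠ 0 ↔ ∃ k, w k ≠ 0 ∧ x k ∈ A := by
  rw [← lintegral_indicator_one hA, lintegral_atomic w x (measurable_one.indicator hA), Ne,
    ENNReal.tsum_eq_zero]
  simp

lemma clusterCount_atomic [MeasurableSingletonClass S] {e : S → ℕ → Bool} (he : Measurable e)
    (hinj : Function.Injective e) (w : ℕ → ℝ≥0∞) (x : ℕ → S) :
    clusterCount e (atomic w x) = {s | atomic w x {s} ≠ 0}.encard := by
  have hcells (m : ℕ) : {c | atomic w x (prefixCode e m ⁻¹' {c}) ≠ 0} =
      prefixCode e m '' {s | atomic w x {s} ≠ 0} := by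
    ext c
    simp only [Set.mem_ofPred_eq, Set.mem_image, atomic_ne_zero_iff w x (measurableSet_singleton _),
      atomic_ne_zero_iff w x (measurable_prefixCode he m (measurableSet_singleton c))]
    aesop
  simp only [clusterCount, hcells]
  refine le_antisymm (iSup_le fun m => Set.encard_image_le _ _)
    (ENat.forall_natCast_le_iff_le.1 fun j hj => ?_)
  obtain ⟨t, ht, htj⟩ := Set.exists_subset_encard_eq hj
  obtain ⟨m, hm⟩ := exists_injOn_prefixCode hinj (Set.finite_of_encard_eq_coe htj)
  calc (j : ℕ∞) = (prefixCode e m '' t).encard := by rw [hm.encard_image, htj]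
    _ ≤ (prefixCode e m '' {s | atomic w x {s} ≠ 0}).encard :=
        Set.encard_le_encard (Set.image_mono ht)
    _ ≤ _ := le_iSup (fun m => (prefixCode e m '' {s | atomic w x {s} ≠ 0}).encard) m

lemma compoundMeasure_eq_atomic (x : ℕ × (ℕ → ℕ × S)) :
    compoundMeasure x =
      atomic (fun k => if k < x.1 then ((x.2 k).1 : ℝ≥0∞) else 0) fun k => (x.2 k).2 := by
  refine Measure.ext_of_lintegral _ fun f hf => ?_
  rw [lintegral_compoundMeasure x hf, lintegral_atomic _ _ hf,
    tsum_eq_sum (s := Finset.range x.1) (by simp +contextual)]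
  exact Finset.sum_congr rfl fun k hk => by rw [if_pos (Finset.mem_range.1 hk)]

lemma encard_atoms_compoundMeasure [MeasurableSingletonClass S] {x : ℕ × (ℕ → ℕ × S)}
    (hsize : ∀ k, (x.2 k).1 ≠ 0) (hloc : Function.Injective fun k => (x.2 k).2) :
    {s | compoundMeasure x {s} ≠ 0}.encard = x.1 := by
  have hatoms : {s | compoundMeasure x {s} ≠ 0} =
      (fun k => (x.2 k).2) '' (Finset.range x.1) := by
    ext s
    rw [compoundMeasure_eq_atomic, Set.mem_ofPred_eq,
      atomic_ne_zero_iff _ _ (measurableSet_singleton s)]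
    simp [hsize]
  rw [hatoms, hloc.encard_image, Set.encard_coe_eq_coe_finsetCard, Finset.card_range]

lemma ae_prod_ne [MeasurableSpace.CountablySeparated S] (μ ν : Measure S) [SFinite ν]
    [NullSingletonClass ν] : ∀ᵐ p ∂(μ.prod ν), p.1 ≠ p.2 := by
  obtain ⟨e, he, hinj⟩ := MeasurableSpace.measurable_injection_nat_bool_of_countablySeparated S
  have hmeas : MeasurableSet {p : S × S | p.1 ≠ p.2} := by
    simp only [ne_eq, ← hinj.eq_iff]
    exact (measurableSet_eq_fun (he.comp measurable_fst) (he.comp measurable_snd)).compl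
  rw [Measure.ae_prod_iff_ae_ae hmeas]
  exact .of_forall fun s => (Measure.ae_ne ν s).mono fun _ => Ne.symm

section CompoundLaw

variable (lam : ℝ≥0) (q : Measure ℕ) [IsProbabilityMeasure q] (g : Measure S)
  [IsProbabilityMeasure g]

instance isProbabilityMeasure_compoundLaw : IsProbabilityMeasure (compoundLaw lam q g) := by
  unfold compoundLaw
  infer_instance

lemma measurePreserving_fst_compoundLaw :
    MeasurePreserving Prod.fst (compoundLaw lam q g) (poissonMeasure lam) :=
  measurePreserving_fst

lemma measurePreserving_snd_compoundLaw :
    MeasurePreserving Prod.snd (compoundLaw lam q g) (Measure.infinitePi fun _ => q.prod g) :=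
  measurePreserving_snd

lemma measurePreserving_eval_compoundLaw (k : ℕ) :
    MeasurePreserving (fun x : ℕ × (ℕ → ℕ × S) => x.2 k) (compoundLaw lam q g) (q.prod g) :=
  (measurePreserving_eval_infinitePi _ k).comp (measurePreserving_snd_compoundLaw lam q g)

lemma ae_size_ne_zero_compoundLaw (hq : q {0} = 0) :
    ∀ᵐ x ∂(compoundLaw lam q g), ∀ k, (x.2 k).1 ≠ 0 := by
  refine ae_all_iff.2 fun k => ?_
  have hne : ∀ᵐ j ∂q, j ≠ 0 := by simpa [ae_iff] using hq
  exact (measurePreserving_fst.comp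
    (measurePreserving_eval_compoundLaw lam q g k)).quasiMeasurePreserving.ae hne

variable [NullSingletonClass g] [MeasurableSpace.CountablySeparated S]

lemma ae_injective_location_compoundLaw :
    ∀ᵐ x ∂(compoundLaw lam q g), Function.Injective fun k => (x.2 k).2 := by
  have hpair (i j : ℕ) (hij : i ≠ j) :
      MeasurePreserving (fun y : ℕ → ℕ × S => (y i, y j))
        (Measure.infinitePi fun _ => q.prod g) ((q.prod g).prod (q.prod g)) :=
    ⟨by fun_prop, Measure.infinitePi_map_eval_prod hij⟩
  have hloc (i j : ℕ) (hij : i ≠ j) :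
      MeasurePreserving (fun x : ℕ × (ℕ → ℕ × S) => ((x.2 i).2, (x.2 j).2))
        (compoundLaw lam q g) (g.prod g) :=
    (measurePreserving_snd.prod measurePreserving_snd).comp
      ((hpair i j hij).comp (measurePreserving_snd_compoundLaw lam q g))
  have hne : ∀ᵐ x ∂(compoundLaw lam q g), ∀ i j : ℕ, i ≠ j → (x.2 i).2 ≠ (x.2 j).2 := by
    simp only [ae_all_iff]
    exact fun i j hij => (hloc i j hij).quasiMeasurePreserving.ae (ae_prod_ne g g)
  filter_upwards [hne] with x hx i j
  exact not_imp_not.1 (hx i j)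

lemma compoundLaw_encard_atoms_eq (hq : q {0} = 0) (j : ℕ) :
    compoundLaw lam q g {x | {s | compoundMeasure x {s} ≠ 0}.encard = j} =
      poissonMeasure lam {j} := by
  have := MeasurableSpace.measurableSingletonClass_of_countablySeparated (α := S)
  rw [← (measurePreserving_fst_compoundLaw lam q g).measure_preimage
    (measurableSet_singleton j).nullMeasurableSet]
  refine measure_congr ?_
  filter_upwards [ae_size_ne_zero_compoundLaw lam q g hq,
    ae_injective_location_compoundLaw lam q g] with x hsize hloc
  refine propext ?_
  change {s | compoundMeasure x {s} ≠ 0}.encard = j ↔ x.1 = j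
  rw [encard_atoms_compoundMeasure hsize hloc, Nat.cast_inj]

end CompoundLaw

end Clusters

section CountMixtureModel

variable {S : Type*} [MeasurableSpace S] {Θ : Type*} [MeasurableSpace Θ]

lemma measurable_countMeasure {ω : ℕ → Θ → S} {n : ℕ → Θ → ℕ} (hω : ∀ k, Measurable (ω k))
    (hn : ∀ k, Measurable (n k)) : Measurable (countMeasure ω n) := by
  refine Measure.measurable_of_measurable_coe _ fun A hA => ?_
  have hind : Measurable (A.indicator (1 : S → ℝ≥0∞)) := measurable_one.indicator hA
  simp only [countMeasure, ← lintegral_indicator_one hA, lintegral_atomic _ _ hind]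
  exact .tsum fun k => (measurable_natCast_mul_comp hind).comp ((hn k).prodMk (hω k))

lemma isCompoundPoissonProcess_of_identDistrib {P : Measure Θ} {X : Θ → Measure S}
    {lam : ℝ≥0} {q : Measure ℕ} [IsProbabilityMeasure q] {g : Measure S} [IsProbabilityMeasure g]
    (h : IdentDistrib X compoundMeasure P (compoundLaw lam q g)) :
    IsCompoundPoissonProcess P X lam q g := by
  have hsnd := measurePreserving_snd_compoundLaw lam q g
  have hpair := measurePreserving_eval_compoundLaw lam q g
  have hsize (k : ℕ) := measurePreserving_fst.comp (hpair k)
  have hloc (k : ℕ) := measurePreserving_snd.comp (hpair k)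
  refine ⟨ℕ × (ℕ → ℕ × S), inferInstance, compoundLaw lam q g, inferInstance, Prod.fst,
    fun k x => (x.2 k).1, fun k x => (x.2 k).2, (measurePreserving_fst_compoundLaw lam q g).hasLaw,
    fun k => (hsize k).hasLaw, fun k => (hloc k).hasLaw, fun k => ?_, ?_, ?_, h⟩
  · refine (indepFun_iff_map_prod_eq_prod_map_map (hsize k).measurable.aemeasurable
      (hloc k).measurable.aemeasurable).2 ?_
    exact (hpair k).map_eq.trans (congrArg₂ Measure.prod (hsize k).map_eq.symm
      (hloc k).map_eq.symm)
  · rw [iIndepFun_iff_map_fun_eq_infinitePi_map fun k => (hpair k).measurable]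
    exact hsnd.map_eq.trans (congrArg Measure.infinitePi (funext fun k => (hpair k).map_eq.symm))
  · exact indepFun_prod (X := fun l : ℕ => l) (Y := fun y : ℕ → ℕ × S => y) measurable_id
      measurable_id

variable {P : Measure Θ} [IsProbabilityMeasure P] {ρ : Measure ℝ≥0} {G₀ : Measure S}
  [IsFiniteMeasure G₀] {r : ℕ → Θ → ℝ≥0} {ω : ℕ → Θ → S} {n : ℕ → Θ → ℕ}

theorem IsCountMixtureModel.identDistrib (h : IsCountMixtureModel P (ρ.prod G₀) r ω n)
    (hν : IsLevyMeasure (ρ.prod G₀)) (hρ : ρ {0}ᶜ ≠ 0) (hG₀ : G₀ ≠ 0) :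
    IdentDistrib (countMeasure ω n) compoundMeasure P
      (compoundLaw (clusterRate ρ G₀) (sizeLaw ρ) (baseLaw G₀)) := by
  have hint := hν.integrable_one_sub_exp_neg hG₀
  have := isProbabilityMeasure_sizeLaw hint hρ
  have := isProbabilityMeasure_baseLaw hG₀
  have hX := measurable_countMeasure h.measurable_atom h.measurable_count
  have hY := measurable_compoundMeasure (S := S)
  refine ⟨hX.aemeasurable, hY.aemeasurable, measure_ext_of_laplaceFunctional fun f hf => ?_⟩
  have hlaplace : Measurable fun m : Measure S => expNeg (∫⁻ s, f s ∂m) :=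
    measurable_expNeg.comp (Measure.measurable_lintegral hf)
  have hthin : Measurable fun s => 1 - expNeg (f s) :=
    measurable_const.sub (measurable_expNeg.comp hf)
  rw [lintegral_map hlaplace hX, lintegral_map hlaplace hY, h.lintegral_expNeg_countMeasure hf,
    h.isCRM.lintegral_expNeg_lintegral hν hthin,
    lintegral_expNeg_compoundMeasure_clusterRate hint hρ hG₀ hf]

theorem IsCountMixtureModel.encard_atoms_countMeasure [NullSingletonClass G₀]
    [MeasurableSpace.CountablySeparated S] (h : IsCountMixtureModel P (ρ.prod G₀) r ω n)
    (hν : IsLevyMeasure (ρ.prod G₀)) (hρ : ρ {0}ᶜ ≠ 0) (hG₀ : G₀ ≠ 0) (j : ℕ) :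
    P {θ | {s | countMeasure ω n θ {s} ≠ 0}.encard = j} =
      poissonMeasure (clusterRate ρ G₀) {j} := by
  have := isProbabilityMeasure_sizeLaw (hν.integrable_one_sub_exp_neg hG₀) hρ
  have := isProbabilityMeasure_baseLaw hG₀
  have : NullSingletonClass (baseLaw G₀) := ⟨fun s => by simp [baseLaw]⟩
  have := MeasurableSpace.measurableSingletonClass_of_countablySeparated (α := S)
  obtain ⟨e, he, hinj⟩ := MeasurableSpace.measurable_injection_nat_bool_of_countablySeparated S
  have hX (θ : Θ) : {s | countMeasure ω n θ {s} ≠ 0}.encard =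
      clusterCount e (countMeasure ω n θ) := (clusterCount_atomic he hinj _ _).symm
  have hY (x : ℕ × (ℕ → ℕ × S)) : {s | compoundMeasure x {s} ≠ 0}.encard =
      clusterCount e (compoundMeasure x) := by
    rw [compoundMeasure_eq_atomic, clusterCount_atomic he hinj]
  rw [← compoundLaw_encard_atoms_eq _ (sizeLaw ρ) (baseLaw G₀) sizeLaw_singleton_zero j]
  simp only [hX, hY]
  exact (h.identDistrib hν hρ hG₀).measure_mem_eq
    (measurable_clusterCount he (measurableSet_singleton (j : ℕ∞)))

end CountMixtureModel

end CountMixture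

end

theorem mainTheorem1 {S : Type*} [MeasurableSpace S] {Θ : Type*} [MeasurableSpace Θ]
    (P : Measure Θ) [IsProbabilityMeasure P]
    (ρ : Measure ℝ≥0) (G₀ : Measure S) [IsFiniteMeasure G₀]
    (hρ : ρ {0}ᶜ ≠ 0) (hG₀ : G₀ ≠ 0)
    (hν : CountMixture.IsLevyMeasure (ρ.prod G₀))
    (r : ℕ → Θ → ℝ≥0) (ω : ℕ → Θ → S) (n : ℕ → Θ → ℕ)
    (hmodel : CountMixture.IsCountMixtureModel P (ρ.prod G₀) r ω n) :
    -- the integrals in the formulas are finite, and the denominator is positive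
    Integrable (fun x : ℝ≥0 => 1 - Real.exp (-x)) ρ ∧
    0 < ∫ x : ℝ≥0, (1 - Real.exp (-x)) ∂ρ ∧
    (∀ j : ℕ, 1 ≤ j → Integrable (fun x : ℝ≥0 => (x : ℝ) ^ j * Real.exp (-x)) ρ) ∧
    -- `X` is a compound Poisson process
    CountMixture.IsCompoundPoissonProcess P (CountMixture.countMeasure ω n)
      (CountMixture.clusterRate ρ G₀) (CountMixture.sizeLaw ρ) (CountMixture.baseLaw G₀) ∧
    -- the number of distinct atoms of `X` is Poisson, for a continuous base measure on a space
    -- whose points are separated by countably many measurable sets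
    (NullSingletonClass G₀ → MeasurableSpace.CountablySeparated S → ∀ j : ℕ,
      P {θ | {s : S | CountMixture.countMeasure ω n θ {s} ≠ 0}.encard = j} =
        poissonMeasure (CountMixture.clusterRate ρ G₀) {j}) := by
  have hint := hν.integrable_one_sub_exp_neg hG₀
  have := CountMixture.isProbabilityMeasure_sizeLaw hint hρ
  have := CountMixture.isProbabilityMeasure_baseLaw hG₀
  exact ⟨hint, CountMixture.integral_one_sub_exp_neg_pos hint hρ,
    fun j hj => CountMixture.integrable_pow_mul_exp_neg hint (Nat.one_le_iff_ne_zero.1 hj),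
    CountMixture.isCompoundPoissonProcess_of_identDistrib (hmodel.identDistrib hν hρ hG₀),
    fun _ _ => hmodel.encard_atoms_countMeasure hν hρ hG₀⟩
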